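/- Let $d\ge 2$ be an integer, and let $R$ be a $[0,\infty)$-valued random variable whose distribution $\mathbb{P}_R$ is absolutely continuous and satisfies $\lim_{h\to\infty}h^{s}\,\mathbb{P}(R>h)=\beta$ with $s=d$ and some $\beta\in(0,\infty)$. For $n\ge 1$ let $\mathbb{T}_n$ be the torus obtained from the cube $[-n/2,n/2]^d$ by identifying opposite faces, with toroidal (Euclidean) distance ${\rm d}_{\mathbb{T}_n}$; write $B_r^{\mathbb{T}_n}(\xi)$ for the closed ball of radius $r$ around $\xi$, $o$ for the origin and $|\xi|={\rm d}_{\mathbb{T}_n}(\xi,o)$. Let $X^{(n)}$ be an independently marked homogeneous Poisson point process on $\mathbb{T}_n$ with intensity $1$ and marks distributed as $R$, i.e. a Poisson point process on $\mathbb{T}_n\times[0,\infty)$ whose intensity measure is the product of the volume on $\mathbb{T}_n$ and $\mathbb{P}_R$. Let $R^*$ be a copy of $R$ that is independent of $X^{(n)}$. For a finite set $\varphi\subset\mathbb{T}_n\times[0,\infty)$, the thinned scale-free Gilbert graph $G'(\varphi)$ is the directed graph on $\varphi$ with an edge from $(\xi,r)$ to $(\eta,t)$ if $\eta\in B_r^{\mathbb{T}_n}(\xi)$,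 $t<r$, and there is no $(\zeta,w)\in\varphi$ with $\zeta\in B_r^{\mathbb{T}_n}(\xi)$, $t<w<r$ and $\eta\in B_w^{\mathbb{T}_n}(\zeta)$. For $\alpha\ge 0$ put $$D'^{,(\alpha)}_{\mathsf{out},n}=\sum_{(\xi,r)\in X^{(n)}}|\xi|^{\alpha}\,1\{((o,R^*),(\xi,r))\text{ is an edge in }G'(\{(o,R^*)\}\cup X^{(n)})\}.$$ Then, as $n\to\infty$, the expected out-degree satisfies $\mathbb{E}D'^{,(0)}_{\mathsf{out},n}\in O(1)$. Moreover, for every $\alpha>0$ there is $\delta>0$ such that $\mathbb{E}D'^{,(\alpha)}_{\mathsf{out},n}\in O(n^{\alpha-\delta})$. -/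

import Mathlib

open MeasureTheory ProbabilityTheory Filter Topology
open scoped NNReal ENNReal

/-- The `d`-dimensional torus of side length `n`, as the product of `d` circles `ℝ / nℤ`. -/
abbrev Torus (d : ℕ) (n : ℝ) : Type := Fin d → AddCircle n

/-- The toroidal distance induced by the Euclidean distance. (The norm on `AddCircle n` is
the distance of a representative to the nearest multiple of `n`.) -/
noncomputable def torusDist {d : ℕ} {n : ℝ} (x y : Torus d n) : ℝ :=
  Real.sqrt (∑ i, ‖x i - y i‖ ^ 2)

/-- The closed ball of radius `r` around `x` in the torus. -/
def torusBall {d : ℕ} {n : ℝ} (x : Torus d n) (r : ℝ) : Set (Torus d n) :=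
  {y | torusDist x y ≤ r}

/-- The volume on the torus: the image of Lebesgue measure on the cube `[-n/2, n/2]^d` under the
identification of its boundaries. -/
noncomputable def torusVolume (d : ℕ) (n : ℝ) : Measure (Torus d n) :=
  ((volume : Measure (Fin d → ℝ)).restrict
    (Set.Icc (fun _ => -(n / 2)) (fun _ => n / 2))).map (fun x i => (x i : AddCircle n))

instance torusVolume_isFinite (d : ℕ) (n : ℝ) : IsFiniteMeasure (torusVolume d n) := by
  have : IsFiniteMeasure ((volume : Measure (Fin d → ℝ)).restrict
      (Set.Icc (fun _ => -(n / 2)) (fun _ => n / 2))) :=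
    ⟨by rw [Measure.restrict_apply_univ]; exact isCompact_Icc.measure_lt_top⟩
  exact Measure.isFiniteMeasure_map _ _

/-- Points of the torus carrying a mark (a radius) in `[0, ∞)`. -/
abbrev MarkedTorus (d : ℕ) (n : ℝ) : Type := Torus d n × ℝ≥0

/-- The number of points of the random set `X` in `B`. -/
noncomputable def pointCount {Ω E : Type*} (X : Ω → Set E) (B : Set E) (ω : Ω) : ℕ :=
  (X ω ∩ B).ncard

/-- The sigma-algebra generated by a point process: the one generated by its counting variables. -/
noncomputable abbrev pointSigma {Ω E : Type*} [MeasurableSpace E] (X : Ω → Set E) : MeasurableSpace Ω :=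
  ⨆ (B : Set E) (_ : MeasurableSet B), MeasurableSpace.comap (pointCount X B) ⊤

/-- `X` is a (simple) Poisson point process on `E` with finite intensity measure `μ`: a random
finite set whose number of points in every measurable set `B` is Poisson distributed with mean
`μ B`, the numbers of points in disjoint sets being independent. -/
structure IsPoissonProcess {Ω E : Type*} [MeasurableSpace Ω] [MeasurableSpace E]
    (X : Ω → Set E) (μ : Measure E) [IsFiniteMeasure μ] (P : Measure Ω) : Prop where
  finite : ∀ ω, (X ω).Finite
  measurable : ∀ B : Set E, MeasurableSet B → Measurable (pointCount X B)
  poisson : ∀ B : Set E, MeasurableSet B →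
    P.map (pointCount X B) = poissonMeasure (μ B).toNNReal
  indep : ∀ (k : ℕ) (B : Fin k → Set E), (∀ i, MeasurableSet (B i)) →
    Pairwise (Function.onFun Disjoint B) → iIndepFun (fun i => pointCount X (B i)) P

/-- `X` is an independently `[0, ∞)`-marked homogeneous Poisson point process of intensity `1` on
the torus, with mark distribution `ρ`: a Poisson process of marked points whose intensity measure
is the product of the volume and `ρ`. -/
def IsMarkedPoisson {Ω : Type*} [MeasurableSpace Ω] {d : ℕ} {n : ℝ}
    (X : Ω → Set (MarkedTorus d n)) (ρ : Measure ℝ≥0) [IsProbabilityMeasure ρ]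
    (P : Measure Ω) : Prop :=
  IsPoissonProcess X ((torusVolume d n).prod ρ) P

/-- The distribution `ρ` on `[0, ∞)` is absolutely continuous (with respect to Lebesgue measure)
and heavy-tailed with tail index `s` and constant `β`, that is, `h ^ s * ρ (h, ∞) → β`. -/
structure IsHeavyTailed (ρ : Measure ℝ≥0) (s β : ℝ) : Prop where
  absolutelyContinuous : ρ.map (fun r : ℝ≥0 => (r : ℝ)) ≪ (volume : Measure ℝ)
  s_pos : 0 < s
  β_pos : 0 < β
  tail : Tendsto (fun h : ℝ≥0 => (h : ℝ) ^ s * ρ.real (Set.Ioi h)) atTop (𝓝 β)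

/-- The thinned scale-free Gilbert graph on a set `φ` of marked points. -/
def thinnedGilbert {d : ℕ} {n : ℝ} (φ : Set (MarkedTorus d n)) : Digraph (MarkedTorus d n) where
  Adj x y := x ∈ φ ∧ y ∈ φ ∧ y.1 ∈ torusBall x.1 x.2 ∧ y.2 < x.2 ∧
    ¬ ∃ z ∈ φ, z.1 ∈ torusBall x.1 x.2 ∧ y.2 < z.2 ∧ z.2 < x.2 ∧ y.1 ∈ torusBall z.1 z.2

/-- The sum of the `α`-th powers of the lengths of the edges that leave the vertex `(o, r)` and end
in a point of `φ`, in the thinned graph on `φ` together with `(o, r)`. -/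
noncomputable def thinnedOutSum {d : ℕ} {n : ℝ} (α : ℝ) (r : ℝ≥0)
    (φ : Set (MarkedTorus d n)) : ℝ≥0∞ :=
  ∑' y : φ, Set.indicator {y | (thinnedGilbert (insert (0, r) φ)).Adj (0, r) y}
    (fun y => ENNReal.ofReal (torusDist y.1 0 ^ α)) (y : MarkedTorus d n)

/-! Split the radius of the origin and the marks into dyadic classes `j` and `k` at a scale `h`.
Radius class `j` has probability of order `2 ^ (-d * j)`. Points of class `k` are sorted into cells
of side of order `2 ^ k`; because `s = d`, volume and tail cancel and each cell has a bounded mean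
number of points (`measure_markedCell_le`). The ball meets about `2 ^ (d * (j - k))` cells.

An edge into a cell survives only if no point blocks it. At each level `l` with `k ≤ l < j` there is
a region of marks in `(h * 2 ^ l, h * 2 ^ (l + 1)]`, of intensity bounded below, any point of which
blocks the whole cell (`exists_blocking_set`). These regions are disjoint from each other and from
the cell, so by independence survival costs a factor `q ^ (j - k)` with `q < 1`. The blocking set
depends on the cell and not on the point in it, so counts of disjoint sets suffice and no Palm
calculus is needed.

What remains is `∑ j, 2 ^ (j * α) * ∑ k, 2 ^ (-d * k) * q ^ (j - k)`. The inner sum is of order `q ^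
j`, which gives boundedness for `α = 0` and otherwise a gain `δ` as soon as `q * 2 ^ δ < 1`. -/

/-! ### Coordinates, distances and volumes on the torus -/

/-- The representative of a point of the torus in the cube `(-n/2, n/2]^d`. -/
noncomputable def torusRep {d : ℕ} {n : ℝ} [Fact (0 < n)] (x : Torus d n) :
    EuclideanSpace ℝ (Fin d) :=
  WithLp.toLp 2 fun i => (AddCircle.equivIoc n (-(n / 2)) (x i) : ℝ)

section TorusRep

variable {d : ℕ} {n : ℝ} [hn : Fact (0 < n)]

lemma torusRep_apply (x : Torus d n) (i : Fin d) :
    torusRep x i = (AddCircle.equivIoc n (-(n / 2)) (x i) : ℝ) := rfl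

lemma torusRep_mem (x : Torus d n) (i : Fin d) :
    torusRep x i ∈ Set.Ioc (-(n / 2)) (n / 2) := by
  have h := (AddCircle.equivIoc n (-(n / 2)) (x i)).2
  exact ⟨h.1, h.2.trans (by linarith)⟩

lemma abs_torusRep_le (x : Torus d n) (i : Fin d) : |torusRep x i| ≤ n / 2 :=
  abs_le.2 ⟨(torusRep_mem x i).1.le, (torusRep_mem x i).2⟩

lemma coe_torusRep (x : Torus d n) (i : Fin d) : ((torusRep x i : ℝ) : AddCircle n) = x i :=
  AddCircle.coe_equivIoc

lemma torusRep_coe {v : Fin d → ℝ} {i : Fin d} (hv : v i ∈ Set.Ioc (-(n / 2)) (n / 2)) :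
    torusRep (fun i => (v i : AddCircle n)) i = v i := by
  rw [torusRep_apply]
  apply AddCircle.equivIoc_coe_of_mem
  rwa [show -(n / 2) + n = n / 2 by ring]

/-- The cube is centred at the origin, so distances to the origin involve no wrap-around. For other
pairs `torusDist_le` gives only an inequality, in the direction that blocking needs. -/
lemma torusDist_zero_right (x : Torus d n) : torusDist x 0 = ‖torusRep x‖ := by
  rw [torusDist, EuclideanSpace.norm_eq]
  congr 1
  refine Finset.sum_congr rfl fun i _ => ?_
  rw [Pi.zero_apply, sub_zero, ← coe_torusRep x i, Real.norm_eq_abs,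
    (AddCircle.norm_coe_eq_abs_iff n hn.out.ne').2]
  rw [abs_of_pos hn.out]
  exact abs_torusRep_le x i

omit hn in
lemma torusDist_comm (x y : Torus d n) : torusDist x y = torusDist y x := by
  simp only [torusDist, norm_sub_rev]

lemma torusDist_le (x y : Torus d n) : torusDist x y ≤ ‖torusRep x - torusRep y‖ := by
  rw [torusDist, EuclideanSpace.norm_eq]
  refine Real.sqrt_le_sqrt (Finset.sum_le_sum fun i _ => ?_)
  have : ‖x i - y i‖ ≤ ‖torusRep x i - torusRep y i‖ := by
    rw [← coe_torusRep x i, ← coe_torusRep y i, ← AddCircle.coe_sub]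
    exact QuotientAddGroup.norm_mk_le_norm
  exact pow_le_pow_left₀ (norm_nonneg _) this 2

lemma measurable_torusRep_apply (i : Fin d) :
    Measurable fun x : Torus d n => torusRep x i := by
  have h : Measurable (AddCircle.equivIoc n (-(n / 2))) :=
    (AddCircle.measurableEquivIoc n (-(n / 2))).measurable
  exact measurable_subtype_coe.comp (h.comp (measurable_pi_apply i))

lemma torusVolume_pi {S : Fin d → Set ℝ} (hS : ∀ i, MeasurableSet (S i)) :
    torusVolume d n {x | ∀ i, torusRep x i ∈ S i} =
      ∏ i, volume (Set.Ioc (-(n / 2)) (n / 2) ∩ S i) := by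
  have hm : MeasurableSet {x : Torus d n | ∀ i, torusRep x i ∈ S i} := by
    rw [Set.ofPred_forall]
    exact MeasurableSet.iInter fun i => measurable_torusRep_apply i (hS i)
  have hc : Measurable fun (x : Fin d → ℝ) (i : Fin d) => (x i : AddCircle n) :=
    measurable_pi_lambda _ fun i =>
      (AddCircle.continuous_mk' n).measurable.comp (measurable_pi_apply i)
  -- The closed and half-open cubes differ by a null set, and on the half-open one `torusRep`
  -- inverts the quotient map.
  have hr : (volume : Measure (Fin d → ℝ)).restrict
      (Set.Icc (fun _ => -(n / 2)) (fun _ => n / 2)) =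
      volume.restrict (Set.univ.pi fun _ => Set.Ioc (-(n / 2)) (n / 2)) :=
    (Measure.restrict_congr_set Measure.univ_pi_Ioc_ae_eq_Icc).symm
  rw [torusVolume, hr, Measure.map_apply hc hm, Measure.restrict_apply (hc hm)]
  have he : (fun (x : Fin d → ℝ) (i : Fin d) => (x i : AddCircle n)) ⁻¹'
      {x | ∀ i, torusRep x i ∈ S i} ∩ Set.univ.pi (fun _ => Set.Ioc (-(n / 2)) (n / 2)) =
      Set.univ.pi fun i => Set.Ioc (-(n / 2)) (n / 2) ∩ S i := by
    ext v
    simp only [Set.mem_inter_iff, Set.mem_preimage, Set.mem_ofPred_eq, Set.mem_univ_pi]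
    constructor
    · rintro ⟨h1, h2⟩ i
      have := h1 i
      rw [torusRep_coe (h2 i)] at this
      exact ⟨h2 i, this⟩
    · intro h
      refine ⟨fun i => ?_, fun i => (h i).1⟩
      rw [torusRep_coe (h i).1]
      exact (h i).2
  rw [he, volume_pi_pi]

lemma measurableSet_torusRep_mem {S : Fin d → Set ℝ} (hS : ∀ i, MeasurableSet (S i)) :
    MeasurableSet {x : Torus d n | ∀ i, torusRep x i ∈ S i} := by
  rw [Set.ofPred_forall]
  exact MeasurableSet.iInter fun i => measurable_torusRep_apply i (hS i)

/-- The box may stick out of the cube, but in every coordinate its half on the side of the origin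
stays inside; hence `ε ^ d` rather than `(2 * ε) ^ d`. -/
lemma pow_le_torusVolume_box {a : EuclideanSpace ℝ (Fin d)} {ε : ℝ} (hε : 0 ≤ ε)
    (hεn : ε ≤ n / 2) (ha : ∀ i, |a i| ≤ n / 2) :
    ENNReal.ofReal (ε ^ d) ≤
      torusVolume d n {x | ∀ i, torusRep x i ∈ Set.Icc (a i - ε) (a i + ε)} := by
  rw [torusVolume_pi fun i => measurableSet_Icc, ENNReal.ofReal_pow hε]
  calc ENNReal.ofReal ε ^ d = ∏ _i : Fin d, ENNReal.ofReal ε := by simp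
    _ ≤ _ := Finset.prod_le_prod' fun i _ => ?_
  have h := abs_le.1 (ha i)
  rcases le_total 0 (a i) with h0 | h0
  · calc ENNReal.ofReal ε = volume (Set.Ioc (a i - ε) (a i)) := by
          rw [Real.volume_Ioc]; congr 1; ring
      _ ≤ volume (Set.Ioc (-(n / 2)) (n / 2) ∩ Set.Icc (a i - ε) (a i + ε)) :=
        measure_mono fun x hx =>
          ⟨⟨by linarith [hx.1], hx.2.trans h.2⟩, hx.1.le, by linarith [hx.2]⟩
  · calc ENNReal.ofReal ε = volume (Set.Ioc (a i) (a i + ε)) := by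
          rw [Real.volume_Ioc]; congr 1; ring
      _ ≤ volume (Set.Ioc (-(n / 2)) (n / 2) ∩ Set.Icc (a i - ε) (a i + ε)) :=
        measure_mono fun x hx =>
          ⟨⟨h.1.trans_lt hx.1, by linarith [hx.2]⟩, by linarith [hx.1], hx.2⟩

/-- The cell with index `z` of the grid of mesh size `s` on the torus. -/
def gridCell (d : ℕ) (n : ℝ) [Fact (0 < n)] (s : ℝ) (z : Fin d → ℤ) : Set (Torus d n) :=
  {x | ∀ i, torusRep x i ∈ Set.Ico (s * z i) (s * (z i + 1))}

lemma measurableSet_gridCell (s : ℝ) (z : Fin d → ℤ) : MeasurableSet (gridCell d n s z) :=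
  measurableSet_torusRep_mem fun _ => measurableSet_Ico

lemma torusVolume_gridCell_le {s : ℝ} (hs : 0 ≤ s) (z : Fin d → ℤ) :
    torusVolume d n (gridCell d n s z) ≤ ENNReal.ofReal (s ^ d) := by
  rw [gridCell, torusVolume_pi fun i => measurableSet_Ico, ENNReal.ofReal_pow hs]
  calc _ ≤ ∏ _i : Fin d, ENNReal.ofReal s := Finset.prod_le_prod' fun i _ => ?_
    _ = _ := by simp
  calc _ ≤ volume (Set.Ico (s * z i) (s * (z i + 1))) := measure_mono Set.inter_subset_right
    _ = ENNReal.ofReal s := by rw [Real.volume_Ico]; congr 1; ring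

/-- A point with coordinates of modulus at most `s * N` lies in one of `(2 * N + 1) ^ d` cells. -/
lemma exists_mem_gridCell {s : ℝ} (hs : 0 < s) {N : ℕ} {x : Torus d n}
    (hx : ∀ i, |torusRep x i| ≤ s * N) :
    ∃ z ∈ Fintype.piFinset fun _ : Fin d => Finset.Icc (-(N : ℤ)) N, x ∈ gridCell d n s z := by
  refine ⟨fun i => ⌊torusRep x i / s⌋, ?_, fun i => ⟨?_, ?_⟩⟩
  · rw [Fintype.mem_piFinset]
    intro i
    have h := abs_le.1 (hx i)
    rw [Finset.mem_Icc]
    constructor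
    · rw [Int.le_floor, le_div_iff₀ hs]
      push_cast
      linarith
    · have : torusRep x i / s ≤ N := by
        rw [div_le_iff₀ hs]; linarith
      exact Int.floor_le_iff.2 (this.trans_lt (by push_cast; linarith))
  · rw [mul_comm, ← le_div_iff₀ hs]
    exact Int.floor_le _
  · rw [mul_comm, ← div_lt_iff₀ hs]
    exact Int.lt_floor_add_one _

lemma card_gridIndex (N : ℕ) :
    (Fintype.piFinset fun _ : Fin d => Finset.Icc (-(N : ℤ)) N).card = (2 * N + 1) ^ d := by
  rw [Fintype.card_piFinset]
  simp only [Int.card_Icc, Finset.prod_const, Finset.card_univ, Fintype.card_fin]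
  congr 1
  omega

omit hn in
lemma EuclideanSpace.norm_le_of_abs_le {x : EuclideanSpace ℝ (Fin d)} {ε : ℝ} (hε : 0 ≤ ε)
    (hx : ∀ i, |x i| ≤ ε) : ‖x‖ ≤ d * ε := by
  rw [EuclideanSpace.norm_eq]
  apply Real.sqrt_le_iff.2 ⟨by positivity, ?_⟩
  calc ∑ i, ‖x i‖ ^ 2 ≤ ∑ _i : Fin d, ε ^ 2 :=
        Finset.sum_le_sum fun i _ => pow_le_pow_left₀ (norm_nonneg _) (hx i) 2
    _ = d * ε ^ 2 := by simp
    _ ≤ (d * ε) ^ 2 := by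
        rw [mul_pow]
        gcongr
        exact_mod_cast Nat.le_self_pow two_ne_zero d

omit hn in
/-- Retracting `x` towards the origin by `u / 2` leaves a ball of radius `u / 8` that stays close
to the points near `x` and does not reach further out than they do. -/
lemma exists_retract (x : EuclideanSpace ℝ (Fin d)) {u : ℝ} (hu : 0 < u) :
    ∃ a : EuclideanSpace ℝ (Fin d), (∀ i, |a i| ≤ |x i|) ∧
      ∀ y v : EuclideanSpace ℝ (Fin d), ‖y - x‖ ≤ u / 8 → ‖v - a‖ ≤ u / 8 →
        ‖v - y‖ ≤ u ∧ (‖v‖ ≤ u ∨ ‖v‖ ≤ ‖y‖) := by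
  -- If `x` is within `u / 2` of the origin, the retraction stops at the origin.
  obtain ⟨a, ha, hax, han⟩ : ∃ a : EuclideanSpace ℝ (Fin d), (∀ i, |a i| ≤ |x i|) ∧
      ‖a - x‖ ≤ u / 2 ∧ (‖a‖ = 0 ∨ ‖a‖ ≤ ‖x‖ - u / 2) := by
    rcases le_total ‖x‖ (u / 2) with h | h
    · exact ⟨0, by simp, by simpa using h, by simp⟩
    · have hx : 0 < ‖x‖ := lt_of_lt_of_le (by positivity) h
      have h1 : u / 2 / ‖x‖ ≤ 1 := (div_le_one hx).2 h
      have h0 : 0 ≤ u / 2 / ‖x‖ := by positivity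
      refine ⟨(1 - u / 2 / ‖x‖) • x, fun i => ?_, ?_, Or.inr ?_⟩
      · rw [PiLp.smul_apply, smul_eq_mul, abs_mul, abs_of_nonneg (by linarith)]
        exact mul_le_of_le_one_left (abs_nonneg _) (by linarith)
      · rw [sub_smul, one_smul, sub_sub_cancel_left, norm_neg, norm_smul, Real.norm_eq_abs,
          abs_of_nonneg h0, div_mul_cancel₀ _ hx.ne']
      · rw [norm_smul, Real.norm_eq_abs, abs_of_nonneg (by linarith), sub_mul, one_mul,
          div_mul_cancel₀ _ hx.ne']
  refine ⟨a, ha, fun y v hy hv => ⟨?_, ?_⟩⟩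
  · calc ‖v - y‖ = ‖(v - a) + (a - x) - (y - x)‖ := by congr 1; abel
      _ ≤ ‖v - a‖ + ‖a - x‖ + ‖y - x‖ :=
        (norm_sub_le _ _).trans (add_le_add_left (norm_add_le _ _) _)
      _ ≤ u := by linarith
  · have h1 : ‖v‖ ≤ ‖v - a‖ + ‖a‖ := by simpa using norm_add_le (v - a) a
    have h2 : ‖x‖ ≤ ‖y - x‖ + ‖y‖ := by
      rw [norm_sub_rev]; simpa using norm_add_le (x - y) y
    rcases han with h | h
    · left; linarith
    · right; linarith

end TorusRep

/-! ### Means and void probabilities of Poisson processes -/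

lemma lintegral_natCast_poissonMeasure (r : ℝ≥0) :
    ∫⁻ k, (k : ℝ≥0∞) ∂(poissonMeasure r) = r := by
  rw [lintegral_countable']
  simp only [poissonMeasure_singleton]
  rw [tsum_eq_zero_add' ENNReal.summable]
  have h : ∀ k : ℕ, ((k + 1 : ℕ) : ℝ≥0∞) *
      ENNReal.ofReal (Real.exp (-r) * (r : ℝ) ^ (k + 1) / (k + 1).factorial) =
      r * ENNReal.ofReal (Real.exp (-r) * (r : ℝ) ^ k / k.factorial) := by
    intro k
    rw [← ENNReal.ofReal_natCast, ← ENNReal.ofReal_coe_nnreal, ← ENNReal.ofReal_mul (by positivity),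
      ← ENNReal.ofReal_mul (by positivity), Nat.factorial_succ]
    congr 1
    push_cast
    field_simp
    ring
  simp only [h, Nat.cast_zero, zero_mul, zero_add]
  rw [ENNReal.tsum_mul_left]
  have h1 := hasSum_one_poissonMeasure r
  rw [← ENNReal.ofReal_tsum_of_nonneg (fun k => by positivity) h1.summable, h1.tsum_eq]
  simp

namespace IsPoissonProcess

variable {Ω E : Type*} [MeasurableSpace Ω] [MeasurableSpace E]
  {X : Ω → Set E} {μ : Measure E} [IsFiniteMeasure μ] {P : Measure Ω}

lemma lintegral_pointCount (hX : IsPoissonProcess X μ P) {B : Set E} (hB : MeasurableSet B) :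
    ∫⁻ ω, (pointCount X B ω : ℝ≥0∞) ∂P = μ B := by
  rw [← lintegral_map (f := fun k : ℕ => (k : ℝ≥0∞)) (by fun_prop) (hX.measurable B hB),
    hX.poisson B hB, lintegral_natCast_poissonMeasure]
  exact ENNReal.coe_toNNReal (measure_ne_top μ B)

lemma measure_pointCount_eq_zero (hX : IsPoissonProcess X μ P) {A : Set E}
    (hA : MeasurableSet A) :
    P {ω | pointCount X A ω = 0} = ENNReal.ofReal (Real.exp (-(μ A).toReal)) := by
  have h : {ω | pointCount X A ω = 0} = pointCount X A ⁻¹' {0} := rfl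
  rw [h, ← Measure.map_apply (hX.measurable A hA) (MeasurableSet.singleton 0), hX.poisson A hA,
    poissonMeasure_singleton]
  simp only [pow_zero, Nat.factorial_zero, Nat.cast_one, mul_one, div_one]
  rfl

omit [MeasurableSpace Ω] in
lemma measurable_pointSigma {B : Set E} (hB : MeasurableSet B) :
    Measurable[pointSigma X] (pointCount X B) :=
  Measurable.of_comap_le (le_iSup₂_of_le (f := fun (B : Set E) (_ : MeasurableSet B) =>
    MeasurableSpace.comap (pointCount X B) ⊤) B hB le_rfl)

lemma pointSigma_le (hX : IsPoissonProcess X μ P) : pointSigma X ≤ ‹MeasurableSpace Ω› :=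
  iSup₂_le fun B hB => (hX.measurable B hB).comap_le

/-- Expected number of points in `B` on the event that `A` is void and an independent variable
lies in `S`. -/
lemma lintegral_indicator_mul_pointCount_mul_void {R : Ω → ℝ≥0} (hX : IsPoissonProcess X μ P)
    (hR : Measurable R)
    (hRX : Indep (MeasurableSpace.comap R inferInstance) (pointSigma X) P)
    {S : Set ℝ≥0} (hS : MeasurableSet S) {A B : Set E} (hA : MeasurableSet A)
    (hB : MeasurableSet B) (hAB : Disjoint B A) :
    ∫⁻ ω, (R ⁻¹' S).indicator 1 ω *
        ((pointCount X B ω : ℝ≥0∞) * {ω | pointCount X A ω = 0}.indicator 1 ω) ∂P =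
      P.map R S * (μ B * ENNReal.ofReal (Real.exp (-(μ A).toReal))) := by
  have hvoid : Measurable (({0} : Set ℕ).indicator (1 : ℕ → ℝ≥0∞)) :=
    Measurable.of_discrete
  have hSR : Measurable[MeasurableSpace.comap R inferInstance]
      ((R ⁻¹' S).indicator (1 : Ω → ℝ≥0∞)) :=
    (measurable_one.indicator hS : Measurable (S.indicator (1 : ℝ≥0 → ℝ≥0∞))).comp
      (comap_measurable R)
  -- Independence enters twice: here between `R` and the process, below between the counts of the
  -- disjoint sets `B` and `A`.
  rw [lintegral_mul_eq_lintegral_mul_lintegral_of_independent_measurableSpace hR.comap_le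
    hX.pointSigma_le hRX hSR]
  · congr 1
    · rw [lintegral_indicator_one (hR hS), Measure.map_apply hR hS]
    · have hind : IndepFun (pointCount X B) (pointCount X A) P := by
        have h := hX.indep 2 ![B, A] (by simp [Fin.forall_fin_two, hA, hB]) (by
          intro i j hij
          fin_cases i <;> fin_cases j
          · exact absurd rfl hij
          · exact hAB
          · exact hAB.symm
          · exact absurd rfl hij)
        exact h.indepFun (i := 0) (j := 1) (by decide)
      have hind' := hind.comp (φ := fun k : ℕ => (k : ℝ≥0∞)) (ψ := ({0} : Set ℕ).indicator 1)
        (by fun_prop) hvoid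
      have h2 := lintegral_mul_eq_lintegral_mul_lintegral_of_indepFun
        ((Measurable.of_discrete (f := fun k : ℕ => (k : ℝ≥0∞))).comp (hX.measurable B hB))
        (hvoid.comp (hX.measurable A hA)) hind'
      rw [← hX.lintegral_pointCount hB, ← hX.measure_pointCount_eq_zero hA,
        ← lintegral_indicator_one (show MeasurableSet {ω | pointCount X A ω = 0} from
          hX.measurable A hA (MeasurableSet.singleton 0))]
      exact h2
  · refine Measurable.mul ?_ ?_
    · exact (Measurable.of_discrete (f := fun k : ℕ => (k : ℝ≥0∞))).comp (measurable_pointSigma hB)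
    · exact hvoid.comp (measurable_pointSigma hA)

end IsPoissonProcess

/-! ### Dyadic classes of marks and radii -/

/-- Along a geometric sequence of thresholds, the tail of a heavy-tailed distribution and its
increments are comparable to a geometric sequence. -/
lemma IsHeavyTailed.exists_geometric_bounds {d : ℕ} (hd : 1 ≤ d) {ρ : Measure ℝ≥0}
    [IsProbabilityMeasure ρ] {β : ℝ} (hρ : IsHeavyTailed ρ d β) :
    ∃ h c C : ℝ, 0 < h ∧ 0 < c ∧ 1 ≤ C ∧ ∀ k : ℕ,
      ρ {t | h * 2 ^ k < (t : ℝ)} ≤ ENNReal.ofReal (C * ((1 / 2) ^ d) ^ k) ∧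
      ENNReal.ofReal (c * ((1 / 2) ^ d) ^ k) ≤
        ρ {t | h * 2 ^ k < (t : ℝ) ∧ (t : ℝ) ≤ h * 2 ^ (k + 1)} := by
  have hβ := hρ.β_pos
  -- With these margins the increments stay positive: the tail shrinks by at least `1 / 2` per
  -- level, and `3 / 4 - 5 / 4 * (1 / 2) = 1 / 8`.
  have h1 := hρ.tail.eventually (Ioo_mem_nhds (show β * (3 / 4) < β by linarith)
    (show β < β * (5 / 4) by linarith))
  obtain ⟨h₀, hh₀⟩ := eventually_atTop.1 h1
  set h : ℝ≥0 := max h₀ 1 with hdef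
  have hpos : (0 : ℝ) < h := by
    have : (1 : ℝ≥0) ≤ h := le_max_right _ _
    exact_mod_cast zero_lt_one.trans_le this
  have hhd : (0 : ℝ) < (h : ℝ) ^ d := by positivity
  set C := max 1 (β * (5 / 4) / (h : ℝ) ^ d) with hC
  have key : ∀ k : ℕ,
      β * (3 / 4) / (h : ℝ) ^ d * ((1 / 2) ^ d) ^ k ≤ ρ.real (Set.Ioi (h * 2 ^ k)) ∧
      ρ.real (Set.Ioi (h * 2 ^ k)) ≤ β * (5 / 4) / (h : ℝ) ^ d * ((1 / 2) ^ d) ^ k := by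
    intro k
    have hk : h₀ ≤ h * 2 ^ k :=
      (le_max_left _ _).trans (le_mul_of_one_le_right zero_le (one_le_pow₀ one_le_two))
    have := hh₀ _ hk
    rw [Real.rpow_natCast] at this
    push_cast at this
    have e : ((h : ℝ) * 2 ^ k) ^ d = (h : ℝ) ^ d / ((1 / 2) ^ d) ^ k := by
      rw [mul_pow, one_div, inv_pow, inv_pow, div_inv_eq_mul, ← pow_mul, ← pow_mul, mul_comm k d]
    rw [e] at this
    have hb : (0 : ℝ) < ((1 / 2) ^ d) ^ k := by positivity
    constructor
    · have := this.1.le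
      rw [div_mul_eq_mul_div, le_div_iff₀ hb] at this
      rw [div_mul_eq_mul_div, div_le_iff₀ hhd]
      linarith
    · have := this.2.le
      rw [div_mul_eq_mul_div, div_le_iff₀ hb] at this
      rw [div_mul_eq_mul_div, le_div_iff₀ hhd]
      linarith
  have hset : ∀ k : ℕ, {t : ℝ≥0 | (h : ℝ) * 2 ^ k < (t : ℝ)} = Set.Ioi (h * 2 ^ k) := by
    intro k
    ext t
    rw [Set.mem_ofPred_eq, Set.mem_Ioi, ← NNReal.coe_lt_coe]
    push_cast
    rfl
  refine ⟨h, β / 8 / (h : ℝ) ^ d, C, hpos, by positivity, le_max_left _ _, fun k => ⟨?_, ?_⟩⟩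
  · rw [hset, ← ofReal_measureReal]
    refine ENNReal.ofReal_le_ofReal ((key k).2.trans ?_)
    gcongr
    exact le_max_right _ _
  · have hd' : {t : ℝ≥0 | (h : ℝ) * 2 ^ k < (t : ℝ) ∧ (t : ℝ) ≤ h * 2 ^ (k + 1)} =
        Set.Ioi (h * 2 ^ k) \ Set.Ioi (h * 2 ^ (k + 1)) := by
      rw [← hset, ← hset]
      ext t
      simp
    rw [hd', ← ofReal_measureReal]
    refine ENNReal.ofReal_le_ofReal ?_
    rw [measureReal_sdiff (Set.Ioi_subset_Ioi (by gcongr <;> simp)) measurableSet_Ioi]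
    have h1 := (key k).1
    have h2 := (key (k + 1)).2
    have hb : ((1 / 2 : ℝ) ^ d) ≤ 1 / 2 := pow_le_of_le_one (by norm_num) (by norm_num) (by omega)
    have h3 : β * (5 / 4) / (h : ℝ) ^ d * ((1 / 2) ^ d) ^ (k + 1) ≤
        β * (5 / 4) / (h : ℝ) ^ d * (((1 / 2) ^ d) ^ k * (1 / 2)) := by
      rw [pow_succ]
      gcongr
    have h4 : β / 8 / (h : ℝ) ^ d * ((1 / 2) ^ d) ^ k =
        β * (3 / 4) / (h : ℝ) ^ d * ((1 / 2) ^ d) ^ k -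
        β * (5 / 4) / (h : ℝ) ^ d * (((1 / 2) ^ d) ^ k * (1 / 2)) := by ring
    linarith

/-- The `k`-th dyadic class of marks, at scale `h`, truncated above level `j`. -/
def markClass (h : ℝ) (j k : ℕ) : Set ℝ≥0 :=
  {t | (k = 0 ∨ h * 2 ^ (k - 1) < (t : ℝ)) ∧ (k ≤ j → (t : ℝ) ≤ h * 2 ^ k)}

/-- The `j`-th dyadic class of radii, at scale `h`, truncated above level `J`. -/
def radiusClass (h : ℝ) (J j : ℕ) : Set ℝ≥0 :=
  {r | (j = 0 ∨ h * 2 ^ j < (r : ℝ)) ∧ (j < J → (r : ℝ) ≤ h * 2 ^ (j + 1))}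

lemma measurableSet_markClass (h : ℝ) (j k : ℕ) : MeasurableSet (markClass h j k) := by
  unfold markClass
  measurability

lemma measurableSet_radiusClass (h : ℝ) (J j : ℕ) : MeasurableSet (radiusClass h J j) := by
  unfold radiusClass
  measurability

lemma exists_mem_markClass {h : ℝ} (j : ℕ) (t : ℝ≥0) :
    ∃ k ∈ Finset.range (j + 2), t ∈ markClass h j k := by
  by_cases ht : ∃ k, k ≤ j ∧ (t : ℝ) ≤ h * 2 ^ k
  · classical
    refine ⟨Nat.find ht, ?_, ?_, fun _ => (Nat.find_spec ht).2⟩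
    · have := (Nat.find_spec ht).1
      rw [Finset.mem_range]
      omega
    · rcases Nat.eq_zero_or_pos (Nat.find ht) with h0 | h0
      · exact Or.inl h0
      · right
        have h1 := Nat.find_min ht (Nat.sub_lt h0 one_pos)
        by_contra! h2
        exact h1 ⟨(Nat.sub_le _ _).trans (Nat.find_spec ht).1, h2⟩
  · push Not at ht
    exact ⟨j + 1, by simp, Or.inr (ht j le_rfl), fun h => by omega⟩

lemma exists_mem_radiusClass {h : ℝ} (J : ℕ) (r : ℝ≥0) :
    ∃ j ∈ Finset.range (J + 1), r ∈ radiusClass h J j := by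
  classical
  set p : ℕ → Prop := fun j => j = 0 ∨ h * 2 ^ j < (r : ℝ) with hp
  have h0 : p 0 := Or.inl rfl
  refine ⟨Nat.findGreatest p J, ?_, Nat.findGreatest_spec (Nat.zero_le J) h0, fun hj => ?_⟩
  · rw [Finset.mem_range]
    exact Nat.lt_succ_of_le (Nat.findGreatest_le J)
  · have h1 := Nat.findGreatest_is_greatest (Nat.lt_succ_self (Nat.findGreatest p J)) hj
    by_contra! h2
    exact h1 (Or.inr h2)

/-- Class `k` starts at level `k - 1`, which costs the factor `2 ^ d`. -/
lemma measure_markClass_le {h C : ℝ} {d : ℕ} {ρ : Measure ℝ≥0} [IsProbabilityMeasure ρ]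
    (hC : 1 ≤ C)
    (hρ : ∀ k : ℕ, ρ {t | h * 2 ^ k < (t : ℝ)} ≤ ENNReal.ofReal (C * ((1 / 2) ^ d) ^ k))
    (j k : ℕ) : ρ (markClass h j k) ≤ ENNReal.ofReal (C * 2 ^ d * ((1 / 2) ^ d) ^ k) := by
  rcases k with _ | k
  · refine prob_le_one.trans ?_
    rw [← ENNReal.ofReal_one]
    refine ENNReal.ofReal_le_ofReal ?_
    rw [pow_zero, mul_one]
    exact one_le_mul_of_one_le_of_one_le hC (one_le_pow₀ one_le_two)
  · refine (measure_mono fun t ht => ?_).trans ((hρ k).trans (ENNReal.ofReal_le_ofReal ?_))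
    · simpa using ht.1
    · rw [pow_succ, mul_comm _ ((1 / 2 : ℝ) ^ d), mul_assoc C, ← mul_assoc (2 ^ d), ← mul_pow]
      norm_num

lemma measure_radiusClass_le {h C : ℝ} {d : ℕ} {ρ : Measure ℝ≥0} [IsProbabilityMeasure ρ]
    (hC : 1 ≤ C)
    (hρ : ∀ k : ℕ, ρ {t | h * 2 ^ k < (t : ℝ)} ≤ ENNReal.ofReal (C * ((1 / 2) ^ d) ^ k))
    (J j : ℕ) : ρ (radiusClass h J j) ≤ ENNReal.ofReal (C * ((1 / 2) ^ d) ^ j) := by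
  rcases j with _ | j
  · refine prob_le_one.trans ?_
    rw [← ENNReal.ofReal_one]
    refine ENNReal.ofReal_le_ofReal ?_
    simpa using hC
  · refine (measure_mono fun t ht => ?_).trans (hρ (j + 1))
    simpa using ht.1

/-! ### Cells and their blocking sets -/

/-- The marked points over a grid cell whose mesh size is adapted to the class of their marks. -/
def markedCell (d : ℕ) (n : ℝ) [Fact (0 < n)] (h : ℝ) (j k : ℕ) (z : Fin d → ℤ) :
    Set (MarkedTorus d n) :=
  gridCell d n (h * 2 ^ k / (8 * d)) z ×ˢ markClass h j k

section Blocking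

variable {d : ℕ} {n : ℝ} [hn : Fact (0 < n)]

lemma measurableSet_markedCell (h : ℝ) (j k : ℕ) (z : Fin d → ℤ) :
    MeasurableSet (markedCell d n h j k z) :=
  (measurableSet_gridCell _ z).prod (measurableSet_markClass h j k)

lemma two_pow_pow_mul_half_pow_pow (d k : ℕ) : ((2 : ℝ) ^ k) ^ d * ((1 / 2) ^ d) ^ k = 1 := by
  rw [← pow_mul, ← pow_mul, mul_comm d k, ← mul_pow]
  norm_num

/-- The tail index equals the dimension: the factor `2 ^ (k * d)` of the volume cancels the tail,
and the bound is uniform in `k`. -/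
lemma measure_markedCell_le {h C : ℝ} {ρ : Measure ℝ≥0} [IsProbabilityMeasure ρ] (hh : 0 < h)
    (hC : 1 ≤ C)
    (hρ : ∀ k : ℕ, ρ {t | h * 2 ^ k < (t : ℝ)} ≤ ENNReal.ofReal (C * ((1 / 2) ^ d) ^ k))
    (j k : ℕ) (z : Fin d → ℤ) :
    ((torusVolume d n).prod ρ) (markedCell d n h j k z) ≤
      ENNReal.ofReal ((h / (8 * d)) ^ d * (C * 2 ^ d)) := by
  rw [markedCell, Measure.prod_prod]
  refine (mul_le_mul' (torusVolume_gridCell_le (by positivity) z)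
    (measure_markClass_le hC hρ j k)).trans ?_
  rw [← ENNReal.ofReal_mul (by positivity)]
  refine ENNReal.ofReal_le_ofReal (le_of_eq ?_)
  calc (h * 2 ^ k / (8 * d)) ^ d * (C * 2 ^ d * ((1 / 2) ^ d) ^ k)
      = (h / (8 * d)) ^ d * (C * 2 ^ d) * ((2 ^ k) ^ d * ((1 / 2) ^ d) ^ k) := by
        rw [mul_div_right_comm, mul_pow]; ring
    _ = _ := by rw [two_pow_pow_mul_half_pow_pow, mul_one]

/-- The vertices that block all edges from the origin to a given marked cell. -/
lemma exists_blocking_set (hd : 1 ≤ d) {h c : ℝ} {ρ : Measure ℝ≥0} [IsProbabilityMeasure ρ]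
    (hh : 0 < h)
    (hρ : ∀ k : ℕ, ENNReal.ofReal (c * ((1 / 2) ^ d) ^ k) ≤
      ρ {t | h * 2 ^ k < (t : ℝ) ∧ (t : ℝ) ≤ h * 2 ^ (k + 1)})
    {j : ℕ} (hj : h * 2 ^ j ≤ n / 2) (J k : ℕ) (z : Fin d → ℤ) :
    ∃ A : Set (MarkedTorus d n), MeasurableSet A ∧ Disjoint (markedCell d n h j k z) A ∧
      ((markedCell d n h j k z).Nonempty →
        ENNReal.ofReal ((h / (8 * d)) ^ d * c * ((j - k : ℕ) : ℝ)) ≤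
          ((torusVolume d n).prod ρ) A) ∧
      ∀ r ∈ radiusClass h J j, ∀ y ∈ markedCell d n h j k z, y.1 ∈ torusBall 0 r →
        ∀ v ∈ A, v.1 ∈ torusBall 0 r ∧ y.2 < v.2 ∧ v.2 < r ∧ y.1 ∈ torusBall v.1 v.2 := by
  have hd0 : (0 : ℝ) < d := by exact_mod_cast hd
  by_cases hne : (markedCell d n h j k z).Nonempty
  swap
  · exact ⟨∅, MeasurableSet.empty, Set.disjoint_empty _, fun h => absurd h hne,
      fun _ _ _ _ _ v hv => absurd hv (Set.notMem_empty v)⟩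
  obtain ⟨x, hx⟩ := hne
  have hu : ∀ l : ℕ, 0 < h * 2 ^ l := fun l => by positivity
  have humono : ∀ {l m : ℕ}, l ≤ m → h * 2 ^ l ≤ h * 2 ^ m := fun hlm => by
    gcongr
    norm_num
  -- One reference point `x` of the cell fixes the blocking regions at all levels, so that they
  -- serve every `y` in the cell.
  choose a ha hav using fun l : ℕ => exists_retract (torusRep x.1) (hu l)
  set box : ℕ → Set (Torus d n) := fun l => {y | ∀ i, torusRep y i ∈
    Set.Icc (a l i - h * 2 ^ l / (8 * d)) (a l i + h * 2 ^ l / (8 * d))} with hbox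
  set slab : ℕ → Set ℝ≥0 := fun l => {t | h * 2 ^ l < (t : ℝ) ∧ (t : ℝ) ≤ h * 2 ^ (l + 1)}
    with hslab
  have hboxm : ∀ l, MeasurableSet (box l) := fun l =>
    measurableSet_torusRep_mem fun i => measurableSet_Icc
  have hslabm : ∀ l, MeasurableSet (slab l) := fun l => by
    simp only [hslab]
    measurability
  -- Marks at these levels exceed those of the cell and are at most `h * 2 ^ j < r`. For `k ≥ j`,
  -- including the unbounded class `j + 1`, the union is empty, in accordance with the truncated `j
  -- - k = 0`.
  set A : Set (MarkedTorus d n) := ⋃ l ∈ Finset.Ico k j, box l ×ˢ slab l with hA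
  have hbetween : ∀ y ∈ markedCell d n h j k z, ∀ v ∈ A, y.2 < v.2 := by
    intro y hy v hv
    simp only [hA, Set.mem_iUnion, Finset.mem_Ico] at hv
    obtain ⟨l, ⟨hkl, hlj⟩, hv⟩ := hv
    have h1 : (y.2 : ℝ) ≤ h * 2 ^ k := hy.2.2 (by omega)
    have h2 : h * 2 ^ l < (v.2 : ℝ) := hv.2.1
    exact_mod_cast (h1.trans (humono hkl)).trans_lt h2
  refine ⟨A, ?_, ?_, fun _ => ?_, ?_⟩
  · exact Finset.measurableSet_biUnion _ fun l _ => (hboxm l).prod (hslabm l)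
  · rw [Set.disjoint_left]
    exact fun y hy hyA => lt_irrefl _ (hbetween y hy y hyA)
  · rw [hA, measure_biUnion_finset]
    · calc ENNReal.ofReal ((h / (8 * d)) ^ d * c * ((j - k : ℕ) : ℝ))
          = ∑ _l ∈ Finset.Ico k j, ENNReal.ofReal ((h / (8 * d)) ^ d * c) := by
            rw [Finset.sum_const, Nat.card_Ico, nsmul_eq_mul, mul_comm,
              ENNReal.ofReal_mul (Nat.cast_nonneg _), ENNReal.ofReal_natCast]
        _ ≤ _ := Finset.sum_le_sum fun l hl => ?_
      rw [Measure.prod_prod]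
      have hlj := (Finset.mem_Ico.1 hl).2
      have hε : h * 2 ^ l / (8 * d) ≤ n / 2 := by
        refine le_trans (div_le_self (hu l).le ?_) ((humono hlj.le).trans hj)
        have : (1 : ℝ) ≤ d := by exact_mod_cast hd
        linarith
      refine le_trans (le_of_eq ?_) (mul_le_mul' (pow_le_torusVolume_box (by positivity) hε
        fun i => (ha l i).trans (abs_torusRep_le x.1 i)) (hρ l))
      rw [← ENNReal.ofReal_mul (by positivity)]
      congr 1
      calc (h / (8 * d)) ^ d * c
          = (h / (8 * d)) ^ d * c * ((2 ^ l) ^ d * ((1 / 2) ^ d) ^ l) := by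
            rw [two_pow_pow_mul_half_pow_pow, mul_one]
        _ = (h * 2 ^ l / (8 * d)) ^ d * (c * ((1 / 2) ^ d) ^ l) := by
            rw [mul_div_right_comm, mul_pow]; ring
    · intro l _ m _ hlm
      rw [Function.onFun, Set.disjoint_left]
      rintro v ⟨-, hv1, hv2⟩ ⟨-, hv3, hv4⟩
      rcases lt_or_gt_of_ne hlm with hlm | hlm
      · exact absurd (hv2.trans (humono hlm)) (not_le.2 hv3)
      · exact absurd (hv4.trans (humono hlm)) (not_le.2 hv1)
    · exact fun l _ => (hboxm l).prod (hslabm l)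
  · intro r hr y hy hyr v hv
    have hyv := hbetween y hy v hv
    simp only [hA, Set.mem_iUnion, Finset.mem_Ico] at hv
    obtain ⟨l, ⟨hkl, hlj⟩, hvb, hvs⟩ := hv
    -- `k ≤ l < j` excludes `j = 0`, the only class without a lower bound.
    have hrj : h * 2 ^ j < (r : ℝ) := hr.1.resolve_left (by omega)
    have hyr' : ‖torusRep y.1‖ ≤ r := by
      rw [← torusDist_zero_right, torusDist_comm]
      exact hyr
    -- The mesh has `8 * d` in its denominator because a Euclidean norm is at most `d` times the
    -- largest coordinate; this yields the `u / 8` of `exists_retract`.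
    have e8 : ∀ m : ℕ, d * (h * 2 ^ m / (8 * d)) = h * 2 ^ m / 8 := fun m => by
      field_simp
    have h1 : ‖torusRep y.1 - torusRep x.1‖ ≤ h * 2 ^ l / 8 := by
      refine le_trans ?_ ((e8 k).trans_le (by linarith [humono hkl]))
      refine EuclideanSpace.norm_le_of_abs_le (by positivity) fun i => ?_
      have h2 := hy.1 i
      have h3 := hx.1 i
      rw [PiLp.sub_apply, abs_le]
      constructor <;> linarith [h2.1, h2.2, h3.1, h3.2]
    have h2 : ‖torusRep v.1 - a l‖ ≤ h * 2 ^ l / 8 := by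
      refine le_trans ?_ (e8 l).le
      refine EuclideanSpace.norm_le_of_abs_le (by positivity) fun i => ?_
      have h3 := hvb i
      rw [PiLp.sub_apply, abs_le]
      constructor <;> linarith [h3.1, h3.2]
    obtain ⟨h3, h4⟩ := hav l _ _ h1 h2
    refine ⟨?_, hyv, ?_, ?_⟩
    · rw [torusBall, Set.mem_ofPred_eq, torusDist_comm, torusDist_zero_right]
      rcases h4 with h4 | h4
      · exact (h4.trans (humono hlj.le)).trans hrj.le
      · exact h4.trans hyr'
    · exact_mod_cast (hvs.2.trans (humono hlj)).trans_lt hrj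
    · exact ((torusDist_le _ _).trans h3).trans hvs.1.le

end Blocking

/-! ### The expectation as a sum over classes and cells -/

/-- The indices of the grid cells of class `k` that meet the ball of radius `h * 2 ^ (j + 1)`. -/
noncomputable def cellIndex (d j k : ℕ) : Finset (Fin d → ℤ) :=
  Fintype.piFinset fun _ => Finset.Icc (-((8 * d * 2 ^ (j + 1 - k) : ℕ) : ℤ))
    (8 * d * 2 ^ (j + 1 - k) : ℕ)

lemma Finset.sum_indicator_one_eq_ncard {E : Type*} (F : Finset E) (B : Set E) :
    ∑ y ∈ F, B.indicator (1 : E → ℝ≥0∞) y = (((F : Set E) ∩ B).ncard : ℝ≥0∞) := by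
  classical
  have h : (F : Set E) ∩ B = ((F.filter (· ∈ B) : Finset E) : Set E) := by
    ext; simp
  rw [h, Set.ncard_coe_finset, Finset.card_filter, Nat.cast_sum]
  refine Finset.sum_congr rfl fun y _ => ?_
  by_cases hy : y ∈ B <;> simp [hy]

section Expectation

variable {d : ℕ} {n : ℝ} [hn : Fact (0 < n)]

lemma exists_mem_markedCell (hd : 1 ≤ d) {h : ℝ} (hh : 0 < h) {J j : ℕ}
    (hJ : n / 2 ≤ h * 2 ^ (J + 1)) (hj : j ≤ J) {r : ℝ≥0} (hr : r ∈ radiusClass h J j)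
    {y : MarkedTorus d n} (hy : y.1 ∈ torusBall 0 r) :
    torusDist y.1 0 ≤ d * (h * 2 ^ (j + 1)) ∧
      ∃ k ∈ Finset.range (j + 2), ∃ z ∈ cellIndex d j k, y ∈ markedCell d n h j k z := by
  have hd0 : (0 : ℝ) < d := by exact_mod_cast hd
  have hyr : ‖torusRep y.1‖ ≤ r := by
    rw [← torusDist_zero_right, torusDist_comm]
    exact hy
  have hcoord : ∀ i, |torusRep y.1 i| ≤ h * 2 ^ (j + 1) := by
    intro i
    rcases hj.lt_or_eq with hj | rfl
    · exact (PiLp.norm_apply_le (torusRep y.1) i).trans (hyr.trans (hr.2 hj))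
    -- The top class `J` has no upper bound on the radius; there the size of the torus bounds the
    -- coordinates.
    · exact (abs_torusRep_le y.1 i).trans hJ
  refine ⟨?_, ?_⟩
  · rw [torusDist_zero_right]
    exact EuclideanSpace.norm_le_of_abs_le (by positivity) hcoord
  · obtain ⟨k, hk, hyk⟩ := exists_mem_markClass (h := h) j y.2
    have hkj : k ≤ j + 1 := by rw [Finset.mem_range] at hk; omega
    have hs : 0 < h * 2 ^ k / (8 * d) := by positivity
    obtain ⟨z, hz, hyz⟩ := exists_mem_gridCell hs (N := 8 * d * 2 ^ (j + 1 - k)) (x := y.1)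
      (fun i => (hcoord i).trans_eq (by
        push_cast
        field_simp
        rw [← pow_add]
        congr 1
        omega))
    exact ⟨k, hk, z, hz, hyz, hyk⟩

/-- The endpoint of an edge lies in some marked cell, and a point of `φ` in the blocking set of that
cell would be the intermediate vertex that the thinning forbids. -/
lemma thinnedOutSum_le (hd : 1 ≤ d) {h : ℝ} (hh : 0 < h) {J j : ℕ}
    (hJ : n / 2 ≤ h * 2 ^ (J + 1)) (hj : j ≤ J) {r : ℝ≥0} (hr : r ∈ radiusClass h J j)
    {φ : Set (MarkedTorus d n)} (hφ : φ.Finite) {A : ℕ → (Fin d → ℤ) → Set (MarkedTorus d n)}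
    (hA : ∀ k z, ∀ y ∈ markedCell d n h j k z, y.1 ∈ torusBall 0 r →
      ∀ v ∈ A k z, v.1 ∈ torusBall 0 r ∧ y.2 < v.2 ∧ v.2 < r ∧ y.1 ∈ torusBall v.1 v.2)
    {α : ℝ} (hα : 0 ≤ α) :
    thinnedOutSum α r φ ≤ ∑ k ∈ Finset.range (j + 2), ∑ z ∈ cellIndex d j k,
      ((φ ∩ markedCell d n h j k z).ncard : ℝ≥0∞) *
        {s : ℕ | s = 0}.indicator 1 (φ ∩ A k z).ncard *
          ENNReal.ofReal ((d * (h * 2 ^ (j + 1))) ^ α) := by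
  lift φ to Finset (MarkedTorus d n) using hφ
  simp only [← Finset.sum_indicator_one_eq_ncard φ (markedCell d n h j _ _), Finset.sum_mul]
  rw [thinnedOutSum, Finset.tsum_subtype' φ fun y => Set.indicator
    {y | (thinnedGilbert (insert (0, r) (φ : Set (MarkedTorus d n)))).Adj (0, r) y}
    (fun y => ENNReal.ofReal (torusDist y.1 0 ^ α)) y]
  rw [Finset.sum_congr rfl fun k _ => Finset.sum_comm, Finset.sum_comm]
  refine Finset.sum_le_sum fun y _ => ?_
  by_cases hadj : y ∈ {y : MarkedTorus d n |
    (thinnedGilbert (insert (0, r) (φ : Set (MarkedTorus d n)))).Adj (0, r) y}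
  swap
  · rw [Set.indicator_of_notMem hadj]
    exact zero_le
  rw [Set.indicator_of_mem hadj]
  obtain ⟨-, -, hyr, -, hno⟩ := hadj
  obtain ⟨hdist, k, hk, z, hz, hyz⟩ := exists_mem_markedCell hd hh hJ hj hr hyr
  have hempty : (φ : Set (MarkedTorus d n)) ∩ A k z = ∅ := by
    refine Set.eq_empty_of_forall_notMem fun v hv => hno ?_
    exact ⟨v, Set.mem_insert_of_mem _ hv.1, hA k z y hyz hyr v hv.2⟩
  refine le_trans ?_ (Finset.single_le_sum (fun _ _ => zero_le) hk)
  refine le_trans ?_ (Finset.single_le_sum (fun _ _ => zero_le) hz)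
  rw [hempty, Set.indicator_of_mem hyz, Set.ncard_empty,
    Set.indicator_of_mem (show (0 : ℕ) ∈ {s : ℕ | s = 0} from rfl)]
  simp only [Pi.one_apply, one_mul]
  exact ENNReal.ofReal_le_ofReal (Real.rpow_le_rpow (Real.sqrt_nonneg _) hdist hα)

/-- Only an upper bound `q` on the void probability per level is required, so `q` may be enlarged to
suit the summation. -/
lemma lintegral_thinnedOutSum_le (hd : 1 ≤ d) {h c C : ℝ} {ρ : Measure ℝ≥0}
    [IsProbabilityMeasure ρ] (hh : 0 < h) (hC : 1 ≤ C)
    (hρC : ∀ k : ℕ, ρ {t | h * 2 ^ k < (t : ℝ)} ≤ ENNReal.ofReal (C * ((1 / 2) ^ d) ^ k))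
    (hρc : ∀ k : ℕ, ENNReal.ofReal (c * ((1 / 2) ^ d) ^ k) ≤
      ρ {t | h * 2 ^ k < (t : ℝ) ∧ (t : ℝ) ≤ h * 2 ^ (k + 1)})
    {J : ℕ} (hJ₁ : h * 2 ^ J ≤ n / 2) (hJ₂ : n / 2 ≤ h * 2 ^ (J + 1))
    {q : ℝ} (hq : Real.exp (-((h / (8 * d)) ^ d * c)) ≤ q)
    {Ω : Type*} [MeasurableSpace Ω] {P : Measure Ω} {X : Ω → Set (MarkedTorus d n)}
    {R : Ω → ℝ≥0} (hX : IsMarkedPoisson X ρ P) (hR : Measurable R) (hRlaw : P.map R = ρ)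
    (hRX : Indep (MeasurableSpace.comap R inferInstance) (pointSigma X) P)
    {α : ℝ} (hα : 0 ≤ α) :
    ∫⁻ ω, thinnedOutSum α (R ω) (X ω) ∂P ≤
      ENNReal.ofReal (∑ j ∈ Finset.range (J + 1), ∑ k ∈ Finset.range (j + 2),
        ((2 * (8 * d * 2 ^ (j + 1 - k)) + 1) ^ d : ℝ) * (C * ((1 / 2) ^ d) ^ j *
          ((h / (8 * d)) ^ d * (C * 2 ^ d) * q ^ (j - k)) * (d * (h * 2 ^ (j + 1))) ^ α)) := by
  have hX' : IsPoissonProcess X ((torusVolume d n).prod ρ) P := hX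
  have hq0 : 0 < q := (Real.exp_pos _).trans_le hq
  -- The empty set serves as a dummy for `j > J`, so that blocking sets can be chosen for all
  -- indices at once.
  have hblock : ∀ j k z, ∃ A : Set (MarkedTorus d n), MeasurableSet A ∧
      Disjoint (markedCell d n h j k z) A ∧ (j ≤ J → (markedCell d n h j k z).Nonempty →
        ENNReal.ofReal ((h / (8 * d)) ^ d * c * ((j - k : ℕ) : ℝ)) ≤
          ((torusVolume d n).prod ρ) A) ∧
      (j ≤ J → ∀ r ∈ radiusClass h J j, ∀ y ∈ markedCell d n h j k z, y.1 ∈ torusBall 0 r →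
        ∀ v ∈ A, v.1 ∈ torusBall 0 r ∧ y.2 < v.2 ∧ v.2 < r ∧ y.1 ∈ torusBall v.1 v.2) := by
    intro j k z
    by_cases hj : j ≤ J
    · have hj' : h * 2 ^ j ≤ n / 2 := by
        refine le_trans ?_ hJ₁
        gcongr
        norm_num
      obtain ⟨A, h1, h2, h3, h4⟩ := exists_blocking_set (n := n) hd hh hρc hj' J k z
      exact ⟨A, h1, h2, fun _ => h3, fun _ => h4⟩
    · exact ⟨∅, MeasurableSet.empty, Set.disjoint_empty _, fun h => absurd h hj,
        fun h => absurd h hj⟩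
  choose A hAm hAd hAμ hAb using hblock
  set F : ℕ → ℕ → (Fin d → ℤ) → Ω → ℝ≥0∞ := fun j k z ω =>
    (R ⁻¹' radiusClass h J j).indicator 1 ω * ((pointCount X (markedCell d n h j k z) ω : ℝ≥0∞) *
      {ω | pointCount X (A j k z) ω = 0}.indicator 1 ω) with hF
  have hFm : ∀ j k z, Measurable (F j k z) := by
    intro j k z
    refine (measurable_one.indicator (hR (measurableSet_radiusClass h J j))).mul
      (Measurable.mul ?_ (measurable_one.indicator ?_))
    · exact (Measurable.of_discrete (f := fun k : ℕ => (k : ℝ≥0∞))).comp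
        (hX'.measurable _ (measurableSet_markedCell h j k z))
    · exact hX'.measurable _ (hAm j k z) (MeasurableSet.singleton 0)
  have hFint : ∀ j k z, j ≤ J → ∫⁻ ω, F j k z ω ∂P ≤
      ENNReal.ofReal (C * ((1 / 2) ^ d) ^ j *
        ((h / (8 * d)) ^ d * (C * 2 ^ d) * q ^ (j - k))) := by
    intro j k z hj
    rw [hF, hX'.lintegral_indicator_mul_pointCount_mul_void hR hRX
      (measurableSet_radiusClass h J j) (hAm j k z) (measurableSet_markedCell h j k z)
      (hAd j k z), hRlaw, ENNReal.ofReal_mul (by positivity)]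
    refine mul_le_mul' (measure_radiusClass_le hC hρC J j) ?_
    -- An empty cell has no blocking estimate but contributes nothing.
    rcases (markedCell d n h j k z).eq_empty_or_nonempty with he | hne
    · rw [he, measure_empty, zero_mul]
      exact zero_le
    · rw [ENNReal.ofReal_mul (by positivity)]
      refine mul_le_mul' (measure_markedCell_le hh hC hρC j k z) (ENNReal.ofReal_le_ofReal ?_)
      have h1 := (ENNReal.ofReal_le_iff_le_toReal (measure_ne_top _ _)).1 (hAμ j k z hj hne)
      calc Real.exp (-(((torusVolume d n).prod ρ) (A j k z)).toReal)
          ≤ Real.exp (((j - k : ℕ) : ℝ) * -((h / (8 * d)) ^ d * c)) :=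
            Real.exp_le_exp.2 (by linarith)
        _ = Real.exp (-((h / (8 * d)) ^ d * c)) ^ (j - k) := Real.exp_nat_mul _ _
        _ ≤ q ^ (j - k) := pow_le_pow_left₀ (Real.exp_pos _).le hq _
  set D : ℕ → ℝ := fun j => (d * (h * 2 ^ (j + 1))) ^ α with hD
  have hD0 : ∀ j, 0 ≤ D j := fun j => Real.rpow_nonneg (by positivity) _
  calc ∫⁻ ω, thinnedOutSum α (R ω) (X ω) ∂P
      ≤ ∫⁻ ω, ∑ j ∈ Finset.range (J + 1), ∑ k ∈ Finset.range (j + 2), ∑ z ∈ cellIndex d j k,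
          F j k z ω * ENNReal.ofReal (D j) ∂P := by
        refine lintegral_mono fun ω => ?_
        obtain ⟨j, hj, hjr⟩ := exists_mem_radiusClass (h := h) J (R ω)
        have hjJ : j ≤ J := Nat.lt_succ_iff.1 (Finset.mem_range.1 hj)
        refine le_trans ?_ (Finset.single_le_sum (fun _ _ => zero_le) hj)
        refine (thinnedOutSum_le hd hh hJ₂ hjJ hjr (hX'.finite ω)
          (fun k z => hAb j k z hjJ _ hjr) hα).trans (le_of_eq ?_)
        refine Finset.sum_congr rfl fun k _ => Finset.sum_congr rfl fun z _ => ?_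
        rw [hF]
        simp only [Set.indicator_of_mem (show ω ∈ R ⁻¹' radiusClass h J j from hjr),
          Pi.one_apply, one_mul]
        rfl
    _ = ∑ j ∈ Finset.range (J + 1), ∑ k ∈ Finset.range (j + 2), ∑ z ∈ cellIndex d j k,
          (∫⁻ ω, F j k z ω ∂P) * ENNReal.ofReal (D j) := by
        have hm : ∀ j k z, Measurable fun ω => F j k z ω * ENNReal.ofReal (D j) :=
          fun j k z => (hFm j k z).mul_const _
        rw [lintegral_finsetSum _ fun j _ => Finset.measurable_fun_sum _ fun k _ =>
          Finset.measurable_fun_sum _ fun z _ => hm j k z]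
        refine Finset.sum_congr rfl fun j _ => ?_
        rw [lintegral_finsetSum _ fun k _ => Finset.measurable_fun_sum _ fun z _ => hm j k z]
        refine Finset.sum_congr rfl fun k _ => ?_
        rw [lintegral_finsetSum _ fun z _ => hm j k z]
        exact Finset.sum_congr rfl fun z _ => lintegral_mul_const _ (hFm j k z)
    _ ≤ _ := by
        rw [ENNReal.ofReal_sum_of_nonneg fun j _ => Finset.sum_nonneg fun k _ =>
          mul_nonneg (by positivity) (mul_nonneg (by positivity) (hD0 j))]
        refine Finset.sum_le_sum fun j hj => ?_
        rw [ENNReal.ofReal_sum_of_nonneg fun k _ =>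
          mul_nonneg (by positivity) (mul_nonneg (by positivity) (hD0 j))]
        refine Finset.sum_le_sum fun k _ => ?_
        refine (Finset.sum_le_card_nsmul _ _ _ fun z _ => mul_le_mul_left
          (hFint j k z (Nat.lt_succ_iff.1 (Finset.mem_range.1 hj))) _).trans (le_of_eq ?_)
        rw [cellIndex, card_gridIndex, nsmul_eq_mul, ← ENNReal.ofReal_mul (by positivity),
          ← ENNReal.ofReal_natCast, ← ENNReal.ofReal_mul (by positivity)]
        push_cast
        rfl

end Expectation

/-! ### Summation of the class bounds -/

/-- Since `b ≤ 1 / 2 ≤ 2 / 3 * q`, the terms with `k ≤ j` are dominated by a geometric series of sum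
`3`; the term `k = j + 1` adds at most one more `q ^ j`. -/
lemma sum_half_pow_mul_pow_le {b q : ℝ} (hb : 0 ≤ b) (hb' : b ≤ 1 / 2) (hq : 3 / 4 ≤ q) (j : ℕ) :
    ∑ k ∈ Finset.range (j + 2), b ^ k * q ^ (j - k) ≤ 4 * q ^ j := by
  have hq0 : 0 < q := by linarith
  have h1 : ∀ k ∈ Finset.range (j + 1), b ^ k * q ^ (j - k) ≤ q ^ j * (2 / 3) ^ k := by
    intro k hk
    have hkj : k ≤ j := Nat.lt_succ_iff.1 (Finset.mem_range.1 hk)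
    calc b ^ k * q ^ (j - k) ≤ (2 / 3 * q) ^ k * q ^ (j - k) := by
          gcongr
          linarith
      _ = (2 / 3) ^ k * (q ^ k * q ^ (j - k)) := by rw [mul_pow, mul_assoc]
      _ = q ^ j * (2 / 3) ^ k := by rw [← pow_add, Nat.add_sub_cancel' hkj, mul_comm]
  have h2 : ∑ k ∈ Finset.range (j + 1), (2 / 3 : ℝ) ^ k ≤ 3 := by
    have := (summable_geometric_of_lt_one (r := (2 / 3 : ℝ)) (by norm_num)
      (by norm_num)).sum_le_tsum (Finset.range (j + 1)) fun k _ => by positivity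
    rw [tsum_geometric_of_lt_one (by norm_num) (by norm_num)] at this
    exact this.trans (by norm_num)
  have h3 : b ^ (j + 1) ≤ q ^ j := by
    rw [pow_succ]
    calc b ^ j * b ≤ b ^ j * 1 := by gcongr; linarith
      _ ≤ q ^ j := by rw [mul_one]; gcongr; linarith
  rw [Finset.sum_range_succ, show j - (j + 1) = 0 by omega, pow_zero, mul_one]
  have h4 : q ^ j * ∑ k ∈ Finset.range (j + 1), (2 / 3 : ℝ) ^ k ≤ q ^ j * 3 := by gcongr
  have h5 := Finset.sum_le_sum h1
  rw [← Finset.mul_sum] at h5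
  linarith

/-- A factor `2 ^ (j * δ)` is moved into the geometric part, which stays summable; the remaining
power is largest at `j = J`. -/
lemma sum_pow_mul_two_pow_rpow_le {q α δ : ℝ} (hq : 0 < q) (hδα : δ ≤ α)
    (hqδ : q * 2 ^ δ < 1) (J : ℕ) :
    ∑ j ∈ Finset.range (J + 1), q ^ j * ((2 : ℝ) ^ j) ^ α ≤
      (1 - q * 2 ^ δ)⁻¹ * ((2 : ℝ) ^ J) ^ (α - δ) := by
  have h0 : 0 < q * 2 ^ δ := by positivity
  have h1 : ∀ j ∈ Finset.range (J + 1), q ^ j * ((2 : ℝ) ^ j) ^ α ≤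
      (q * 2 ^ δ) ^ j * ((2 : ℝ) ^ J) ^ (α - δ) := by
    intro j hj
    have hjJ : j ≤ J := Nat.lt_succ_iff.1 (Finset.mem_range.1 hj)
    have e1 : ((2 : ℝ) ^ j) ^ α = (2 ^ δ) ^ j * ((2 : ℝ) ^ j) ^ (α - δ) := by
      rw [← Real.rpow_natCast (2 ^ δ) j, ← Real.rpow_mul zero_le_two, mul_comm δ,
        Real.rpow_mul zero_le_two, Real.rpow_natCast, ← Real.rpow_add (by positivity)]
      congr 1
      ring
    have e2 : ((2 : ℝ) ^ j) ^ (α - δ) ≤ ((2 : ℝ) ^ J) ^ (α - δ) :=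
      Real.rpow_le_rpow (by positivity) (pow_le_pow_right₀ one_le_two hjJ) (by linarith)
    rw [e1, ← mul_assoc, mul_pow]
    gcongr
  refine (Finset.sum_le_sum h1).trans ?_
  rw [← Finset.sum_mul]
  refine mul_le_mul_of_nonneg_right ?_ (by positivity)
  have := (summable_geometric_of_lt_one h0.le hqδ).sum_le_tsum (Finset.range (J + 1))
    fun k _ => by positivity
  rwa [tsum_geometric_of_lt_one h0.le hqδ] at this

lemma sum_class_bounds_le {d : ℕ} (hd : 1 ≤ d) {h C q α δ : ℝ} (hh : 0 < h) (hC : 1 ≤ C)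
    (hq : 3 / 4 ≤ q) (hδα : δ ≤ α) (hqδ : q * 2 ^ δ < 1) :
    ∃ K : ℝ, 0 ≤ K ∧ ∀ J : ℕ,
      ∑ j ∈ Finset.range (J + 1), ∑ k ∈ Finset.range (j + 2),
        ((2 * (8 * d * 2 ^ (j + 1 - k)) + 1) ^ d : ℝ) * (C * ((1 / 2) ^ d) ^ j *
          ((h / (8 * d)) ^ d * (C * 2 ^ d) * q ^ (j - k)) * (d * (h * 2 ^ (j + 1))) ^ α) ≤
      K * ((2 : ℝ) ^ J) ^ (α - δ) := by
  have hd1 : (1 : ℝ) ≤ d := by exact_mod_cast hd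
  have hq0 : 0 < q := by linarith
  set b : ℝ := (1 / 2) ^ d with hb
  have hb0 : 0 < b := by positivity
  have hb2 : b ≤ 1 / 2 := pow_le_of_le_one (by norm_num) (by norm_num) (by omega)
  set M : ℝ := (17 * d) ^ d * 2 ^ d * C * ((h / (8 * d)) ^ d * (C * 2 ^ d)) * (2 * d * h) ^ α
    with hM
  have hM0 : 0 ≤ M := by positivity
  have hpos : 0 < 1 - q * 2 ^ δ := by linarith
  refine ⟨M * 4 * (1 - q * 2 ^ δ)⁻¹, by positivity, fun J => ?_⟩
  have hterm : ∀ j, ∀ k ∈ Finset.range (j + 2),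
      ((2 * (8 * d * 2 ^ (j + 1 - k)) + 1) ^ d : ℝ) * (C * b ^ j *
          ((h / (8 * d)) ^ d * (C * 2 ^ d) * q ^ (j - k)) * (d * (h * 2 ^ (j + 1))) ^ α) ≤
        M * ((2 : ℝ) ^ j) ^ α * (b ^ k * q ^ (j - k)) := by
    intro j k hk
    have hkj : k ≤ j + 1 := by rw [Finset.mem_range] at hk; omega
    have e1 : ((2 * (8 * d * 2 ^ (j + 1 - k)) + 1) ^ d : ℝ) ≤
        (17 * d) ^ d * (2 ^ (j + 1 - k)) ^ d := by
      rw [← mul_pow]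
      have : (1 : ℝ) ≤ d * 2 ^ (j + 1 - k) :=
        one_le_mul_of_one_le_of_one_le hd1 (one_le_pow₀ one_le_two)
      gcongr
      linarith
    -- The number of cells against the rarity of a large radius leaves only `b ^ k`.
    have e2 : ((2 : ℝ) ^ (j + 1 - k)) ^ d * b ^ j = 2 ^ d * b ^ k := by
      have h1 : (2 : ℝ) ^ d * b = 1 := by rw [hb, ← mul_pow]; norm_num
      have h2 := two_pow_pow_mul_half_pow_pow d (j + 1 - k)
      have h3 : b ^ (j + 1) = b ^ (j + 1 - k) * b ^ k := by
        rw [← pow_add, Nat.sub_add_cancel hkj]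
      calc ((2 : ℝ) ^ (j + 1 - k)) ^ d * b ^ j
          = ((2 : ℝ) ^ (j + 1 - k)) ^ d * b ^ j * (2 ^ d * b) := by rw [h1, mul_one]
        _ = ((2 : ℝ) ^ (j + 1 - k)) ^ d * b ^ (j + 1) * 2 ^ d := by rw [pow_succ b]; ring
        _ = ((2 : ℝ) ^ (j + 1 - k)) ^ d * b ^ (j + 1 - k) * (2 ^ d * b ^ k) := by rw [h3]; ring
        _ = 2 ^ d * b ^ k := by rw [h2, one_mul]
    have e3 : (d * (h * 2 ^ (j + 1))) ^ α = (2 * d * h) ^ α * ((2 : ℝ) ^ j) ^ α := by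
      rw [← Real.mul_rpow (by positivity) (by positivity)]
      congr 1
      ring
    calc _ ≤ (17 * d) ^ d * (2 ^ (j + 1 - k)) ^ d * (C * b ^ j *
          ((h / (8 * d)) ^ d * (C * 2 ^ d) * q ^ (j - k)) * (d * (h * 2 ^ (j + 1))) ^ α) := by
          gcongr
      _ = (17 * d) ^ d * C * ((h / (8 * d)) ^ d * (C * 2 ^ d)) * q ^ (j - k) *
          ((2 ^ (j + 1 - k)) ^ d * b ^ j) * (d * (h * 2 ^ (j + 1))) ^ α := by ring
      _ = _ := by rw [e2, e3, hM]; ring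
  calc _ ≤ ∑ j ∈ Finset.range (J + 1), M * 4 * (q ^ j * ((2 : ℝ) ^ j) ^ α) := by
        refine Finset.sum_le_sum fun j _ => (Finset.sum_le_sum (hterm j)).trans ?_
        rw [← Finset.mul_sum]
        calc _ ≤ M * ((2 : ℝ) ^ j) ^ α * (4 * q ^ j) := by
              gcongr
              exact sum_half_pow_mul_pow_le hb0.le hb2 hq j
          _ = _ := by ring
    _ ≤ _ := by
        rw [← Finset.mul_sum, mul_assoc (M * 4)]
        gcongr
        exact sum_pow_mul_two_pow_rpow_le hq0 hδα hqδ J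

/-! ### Conclusion -/

theorem theorem6 (d : ℕ) (hd : 2 ≤ d)
    (ρ : Measure ℝ≥0) [IsProbabilityMeasure ρ] (β : ℝ) (hρ : IsHeavyTailed ρ (d : ℝ) β)
    {Ω : ℝ → Type*} [∀ n, MeasurableSpace (Ω n)]
    (P : ∀ n, Measure (Ω n)) [∀ n, IsProbabilityMeasure (P n)]
    (X : ∀ n, Ω n → Set (MarkedTorus d n)) (R : ∀ n, Ω n → ℝ≥0)
    (hX : ∀ n, 1 ≤ n → IsMarkedPoisson (X n) ρ (P n))
    (hRmeas : ∀ n, 1 ≤ n → Measurable (R n))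
    (hRlaw : ∀ n, 1 ≤ n → (P n).map (R n) = ρ)
    (hRX : ∀ n, 1 ≤ n →
      Indep (MeasurableSpace.comap (R n) inferInstance) (pointSigma (X n)) (P n)) :
    (∃ C : ℝ≥0, ∀ᶠ n : ℝ in atTop,
      ∫⁻ ω, thinnedOutSum 0 (R n ω) (X n ω) ∂(P n) ≤ C) ∧
    ∀ α : ℝ, 0 < α → ∃ δ : ℝ, 0 < δ ∧ ∃ C : ℝ≥0, ∀ᶠ n : ℝ in atTop,
      ∫⁻ ω, thinnedOutSum α (R n ω) (X n ω) ∂(P n) ≤ C * ENNReal.ofReal (n ^ (α - δ)) := by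
  have hd1 : 1 ≤ d := by omega
  obtain ⟨h, c, C, hh, hc, hC, hbounds⟩ := hρ.exists_geometric_bounds hd1
  have hd0 : (0 : ℝ) < d := by exact_mod_cast hd1
  set q : ℝ := max (3 / 4) (Real.exp (-((h / (8 * d)) ^ d * c))) with hqdef
  have hq1 : q < 1 := max_lt (by norm_num) (Real.exp_lt_one_iff.2 (neg_lt_zero.2 (by positivity)))
  have key : ∀ α δ : ℝ, 0 ≤ α → δ ≤ α → q * 2 ^ δ < 1 → ∃ K : ℝ≥0, ∀ᶠ n : ℝ in atTop,
      ∫⁻ ω, thinnedOutSum α (R n ω) (X n ω) ∂(P n) ≤ K * ENNReal.ofReal (n ^ (α - δ)) := by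
    intro α δ hα hδα hqδ
    obtain ⟨K, hK, hKJ⟩ := sum_class_bounds_le hd1 hh hC (q := q) (le_max_left _ _) hδα hqδ
    -- The extra factor converts `2 ^ J ≤ n / (2 * h)` into a power of `n`.
    refine ⟨(K * (1 / (2 * h)) ^ (α - δ)).toNNReal, ?_⟩
    filter_upwards [eventually_ge_atTop 1, eventually_ge_atTop (2 * h)] with n hn1 hnh
    have : Fact (0 < n) := ⟨by linarith⟩
    -- `J` is the last level at which `h * 2 ^ J` still fits into half the side of the torus.
    obtain ⟨J, hJ₁, hJ₂⟩ := exists_nat_pow_near (x := n / (2 * h)) (y := 2)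
      ((one_le_div (by positivity)).2 hnh) one_lt_two
    have hJ₁' : h * 2 ^ J ≤ n / 2 := by
      rw [le_div_iff₀ (by positivity)] at hJ₁
      linarith
    have hJ₂' : n / 2 ≤ h * 2 ^ (J + 1) := by
      rw [div_lt_iff₀ (by positivity)] at hJ₂
      linarith
    refine (lintegral_thinnedOutSum_le hd1 hh hC (fun k => (hbounds k).1)
      (fun k => (hbounds k).2) hJ₁' hJ₂' (q := q) (le_max_right _ _) (hX n hn1) (hRmeas n hn1)
      (hRlaw n hn1) (hRX n hn1) hα).trans ?_
    rw [← ENNReal.ofReal, ← ENNReal.ofReal_mul (by positivity)]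
    refine ENNReal.ofReal_le_ofReal ((hKJ J).trans ?_)
    rw [mul_assoc, ← Real.mul_rpow (by positivity) (by linarith), one_div_mul_eq_div]
    gcongr
  refine ⟨?_, fun α hα => ?_⟩
  · obtain ⟨K, hK⟩ := key 0 0 le_rfl le_rfl (by simpa using hq1)
    exact ⟨K, by simpa using hK⟩
  · have hcont : ContinuousAt (fun δ : ℝ => q * 2 ^ δ) 0 :=
      continuousAt_const.mul (Real.continuousAt_const_rpow two_ne_zero)
    have hlt : ∀ᶠ δ : ℝ in 𝓝[>] 0, q * 2 ^ δ < 1 :=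
      (hcont.eventually_lt continuousAt_const (by simpa using hq1)).filter_mono
        nhdsWithin_le_nhds
    obtain ⟨δ, hδ, hδ0, hδα⟩ := (hlt.and (Ioo_mem_nhdsGT hα)).exists
    exact ⟨δ, hδ0, key α δ hα.le hδα.le hδ⟩
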